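/- A \emph{rack} is a set $R$ with two binary operations $\lhd,\lhd^{-1}$ such that $(x\lhd y)\lhd z=(x\lhd z)\lhd(y\lhd z)$, $(x\lhd^{-1} y)\lhd^{-1} z=(x\lhd^{-1} z)\lhd^{-1}(y\lhd^{-1} z)$, $(x\lhd y)\lhd^{-1}y=x$ and $(x\lhd^{-1}y)\lhd y=x$ for all $x,y,z\in R$; let $\mathsf{Rack}$ be the category of racks and homomorphisms. Write $\lhd^{+1}$ for $\lhd$, and bracket iterated operations to the left. Let $n\ge 0$, and let $\mathsf{R}_n$ be the free rack on generators $\mathsf{y}_1,\dots,\mathsf{y}_n$ (closed terms in $\lhd,\lhd^{-1}$ over the constants $\mathsf{y}_1,\dots,\mathsf{y}_n$, modulo provable equality from the rack axioms). Let $\mathcal{Z}(\mathsf{R}_n)$ be the group of natural automorphisms of the projection functor $\mathsf{R}_n/\mathsf{Rack}\to\mathsf{Rack}$ from the category of racks under $\mathsf{R}_n$; its elements are families $\pi=(\pi_h:R\to R)$ of automorphisms indexed by the rack homomorphisms $h:\mathsf{R}_n\to R$. An endomorphism $f$ of $\mathsf{R}_n$ is a \emph{categorical inner automorphism} if $f=\pi_{\mathrm{id}}$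 for some $\pi\in\mathcal{Z}(\mathsf{R}_n)$. An automorphism $f$ of a rack $R$ is an \emph{algebraic inner automorphism} if there are $p,m\ge 0$, signs $\delta_1,\dots,\delta_p,\epsilon_1,\dots,\epsilon_m\in\{1,-1\}$ and elements $r_1,\dots,r_m\in R$ with \[ f(r)=r\lhd^{\delta_1}r\lhd^{\delta_2}\cdots\lhd^{\delta_p}r\lhd^{\epsilon_1}r_1\lhd^{\epsilon_2}\cdots\lhd^{\epsilon_m}r_m\qquad\text{for all } r\in R. \] For a rack $R$, elements $a_1,\dots,a_n,r\in R$, an integer $z$ and a reduced group word $w=\mathsf{y}_{i_1}^{\epsilon_1}\cdots\mathsf{y}_{i_m}^{\epsilon_m}$ (with $m\ge0$, $\epsilon_j=\pm1$) put \[ \Phi_{z,w}(a_1,\dots,a_n;r)=r\lhd^{\delta_1}r\lhd^{\delta_2}\cdots\lhd^{\delta_{|z|}}r\lhd^{\epsilon_1}a_{i_1}\lhd^{\epsilon_2}\cdots\lhd^{\epsilon_m}a_{i_m}\in R, \] where all $\delta_j$ are $1$ if $z>0$ and $-1$ if $z<0$. \begin{enumerate} \item Let $\pi=(\pi_h)_h$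 be a (not necessarily natural) family of rack endomorphisms $\pi_h:R\to R$, indexed by all rack homomorphisms $h:\mathsf{R}_n\to R$ into arbitrary racks $R$. Then $\pi\in\mathcal{Z}(\mathsf{R}_n)$ if and only if there is a unique pair $(z,w)$ of an integer $z$ and a reduced word $w$ in $\mathsf{y}_1,\dots,\mathsf{y}_n$ such that $\pi_h(r)=\Phi_{z,w}(h(\mathsf{y}_1),\dots,h(\mathsf{y}_n);r)$ for every rack homomorphism $h:\mathsf{R}_n\to R$ and every $r\in R$. \item A rack endomorphism $f:\mathsf{R}_n\to\mathsf{R}_n$ is a categorical inner automorphism if and only if there are an integer $z$ and a reduced word $w$ with $f(s)=\Phi_{z,w}(\mathsf{y}_1,\dots,\mathsf{y}_n;s)$ for all $s\in\mathsf{R}_n$. If $n\ge2$, it is a categorical inner automorphism if and only if there is a unique such pair $(z,w)$. \item A rack automorphism $f:\mathsf{R}_n\to\mathsf{R}_n$ is a categorical inner automorphism if and only if it is an algebraic inner automorphism. \end{enumerate} -/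

import Mathlib

universe u

open CategoryTheory
open scoped Quandles

namespace RackIsotropy

/-! Racks are Mathlib's `Rack`. The right-handed operations `x ◁ y` and `x ◁⁻¹ y` (the element `y`
acts on `x`) are `y ◃ x` and `y ◃⁻¹ x` in Mathlib's notation, so that `Shelf.self_distrib` reads
`(x ◁ y) ◁ z = (x ◁ z) ◁ (y ◁ z)`, and the other two axioms read `(x ◁ y) ◁⁻¹ y = x` and
`(x ◁⁻¹ y) ◁ y = x`. -/

section Operations

variable {R : Type u} [Rack R]

/-- `lhdPow x ε y` is `x ◁ y` for `ε = true` (exponent `+1`) and `x ◁⁻¹ y` for `ε = false`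
(exponent `-1`). -/
def lhdPow (x : R) (ε : Bool) (y : R) : R :=
  match ε with
  | true => y ◃ x
  | false => y ◃⁻¹ x

/-- `(…((x ◁^{δ₁} r) ◁^{δ₂} r) …) ◁^{δ_p} r`. -/
def iterSelf (x r : R) (δ : List Bool) : R :=
  δ.foldl (fun a d => lhdPow a d r) x

/-- `(…((x ◁^{ε₁} r₁) ◁^{ε₂} r₂) …) ◁^{ε_m} r_m`. -/
def iterWord (x : R) (w : List (R × Bool)) : R :=
  w.foldl (fun a p => lhdPow a p.2 p.1) x

/-- `r ◁^{δ₁} r … ◁^{δ_z} r ◁^{ε₁} a_{i₁} … ◁^{ε_m} a_{i_m}`, bracketed to the left, for an integer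
`z` and a group word `y_{i₁}^{ε₁} … y_{i_m}^{ε_m}`: there are `|z|` exponents `δ`, all equal to the
sign of `z`. -/
def canonicalValue {n : ℕ} (a : Fin n → R) (z : ℤ) (w : List (Fin n × Bool)) (r : R) : R :=
  iterWord (iterSelf r r (List.replicate z.natAbs (decide (0 < z))))
    (w.map fun p => (a p.1, p.2))

/-- `f` is of the form `r ↦ r ◁^{δ₁} r … ◁^{δ_p} r ◁^{ε₁} r₁ … ◁^{ε_m} r_m` for fixed signs and fixed
elements `r₁, …, r_m` of the rack. -/
def IsAlgebraicInner (f : R → R) : Prop :=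
  ∃ (δ : List Bool) (w : List (R × Bool)), ∀ r : R, f r = iterWord (iterSelf r r δ) w

end Operations

/-- The category of racks in the universe `u`. -/
structure RackCat : Type (u + 1) where
  of ::
  carrier : Type u
  [rack : Rack carrier]

attribute [instance] RackCat.rack

instance : CoeSort RackCat.{u} (Type u) := ⟨RackCat.carrier⟩

instance : Category RackCat.{u} where
  Hom A B := A →◃ B
  id A := ShelfHom.id A
  comp f g := ShelfHom.comp g f

instance : ConcreteCategory RackCat.{u} (fun A B => A →◃ B) where
  hom f := f
  ofHom f := f

/-- Closed terms over two binary operation symbols and `n` constants. -/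
inductive RackTerm (n : ℕ) : Type u
  | gen (i : Fin n) : RackTerm n
  | lhd (s t : RackTerm n) : RackTerm n
  | lhdInv (s t : RackTerm n) : RackTerm n

/-- Equality of closed terms provable from the rack axioms: the least congruence that contains
all closed instances of the axioms. -/
inductive RackTerm.Equiv {n : ℕ} : RackTerm.{u} n → RackTerm.{u} n → Prop
  | refl (s) : Equiv s s
  | symm {s t} : Equiv s t → Equiv t s
  | trans {s t r} : Equiv s t → Equiv t r → Equiv s r
  | congr_lhd {s s' t t'} : Equiv s s' → Equiv t t' → Equiv (lhd s t) (lhd s' t')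
  | congr_lhdInv {s s' t t'} : Equiv s s' → Equiv t t' → Equiv (lhdInv s t) (lhdInv s' t')
  | distrib (x y z) : Equiv (lhd (lhd x y) z) (lhd (lhd x z) (lhd y z))
  | distribInv (x y z) :
      Equiv (lhdInv (lhdInv x y) z) (lhdInv (lhdInv x z) (lhdInv y z))
  | lhd_lhdInv (x y) : Equiv (lhdInv (lhd x y) y) x
  | lhdInv_lhd (x y) : Equiv (lhd (lhdInv x y) y) x

/-- Provable equality as a setoid. -/
def RackTerm.setoid (n : ℕ) : Setoid (RackTerm.{u} n) where
  r := RackTerm.Equiv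
  iseqv := ⟨RackTerm.Equiv.refl, RackTerm.Equiv.symm, RackTerm.Equiv.trans⟩

/-- The free rack on `n` generators: closed terms modulo provable equality. -/
def FreeRack (n : ℕ) : Type u :=
  Quotient (RackTerm.setoid.{u} n)

namespace FreeRack

instance (n : ℕ) : Rack (FreeRack.{u} n) where
  act a b := Quotient.map₂ (fun t s => RackTerm.lhd s t)
    (fun _ _ ht _ _ hs => RackTerm.Equiv.congr_lhd hs ht) a b
  invAct a b := Quotient.map₂ (fun t s => RackTerm.lhdInv s t)
    (fun _ _ ht _ _ hs => RackTerm.Equiv.congr_lhdInv hs ht) a b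
  self_distrib {x y z} := by
    induction x, y using Quotient.inductionOn₂ with
    | _ x y =>
      induction z using Quotient.inductionOn with
      | _ z => exact Quotient.sound (RackTerm.Equiv.distrib z y x)
  left_inv x y := by
    induction x, y using Quotient.inductionOn₂ with
    | _ x y => exact Quotient.sound (RackTerm.Equiv.lhd_lhdInv y x)
  right_inv x y := by
    induction x, y using Quotient.inductionOn₂ with
    | _ x y => exact Quotient.sound (RackTerm.Equiv.lhdInv_lhd y x)

/-- The class of a closed term. -/
def mk {n : ℕ} (t : RackTerm.{u} n) : FreeRack.{u} n :=
  Quotient.mk (RackTerm.setoid n) t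

/-- The `i`-th generator. -/
def gen {n : ℕ} (i : Fin n) : FreeRack.{u} n :=
  mk (RackTerm.gen i)

end FreeRack

/-- The value of a closed term in a rack with chosen values of the constants. -/
def RackTerm.eval {n : ℕ} {S : Type*} [Rack S] (a : Fin n → S) : RackTerm.{u} n → S
  | .gen i => a i
  | .lhd s t => RackTerm.eval a t ◃ RackTerm.eval a s
  | .lhdInv s t => RackTerm.eval a t ◃⁻¹ RackTerm.eval a s

theorem RackTerm.eval_eq {n : ℕ} {S : Type*} [Rack S] (a : Fin n → S) {s t : RackTerm.{u} n}
    (h : RackTerm.Equiv s t) : RackTerm.eval a s = RackTerm.eval a t := by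
  induction h with
  | refl => rfl
  | symm _ ih => exact ih.symm
  | trans _ _ ih₁ ih₂ => exact ih₁.trans ih₂
  | congr_lhd _ _ ih₁ ih₂ => simp only [RackTerm.eval, ih₁, ih₂]
  | congr_lhdInv _ _ ih₁ ih₂ => simp only [RackTerm.eval, ih₁, ih₂]
  | distrib x y z => exact Shelf.self_distrib
  | distribInv x y z => exact Rack.self_distrib_inv
  | lhd_lhdInv x y => exact Rack.left_inv _ _
  | lhdInv_lhd x y => exact Rack.right_inv _ _

/-- The universal property of the free rack. -/
theorem FreeRack.existsUnique_hom {n : ℕ} {S : Type*} [Rack S] (a : Fin n → S) :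
    ∃! f : FreeRack.{u} n →◃ S, ∀ i, f (FreeRack.gen i) = a i := by
  refine ⟨⟨Quotient.lift (RackTerm.eval a) fun _ _ h => RackTerm.eval_eq a h, ?_⟩,
    fun i => rfl, ?_⟩
  · intro x y
    induction x, y using Quotient.inductionOn₂ with
    | _ x y => rfl
  · intro g hg
    have key : ∀ t : RackTerm.{u} n, g (FreeRack.mk t) = RackTerm.eval a t := by
      intro t
      induction t with
      | gen i => exact hg i
      | lhd s t ihs iht =>
        have h := g.map_act (x := FreeRack.mk t) (y := FreeRack.mk s)
        rw [ihs, iht] at h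
        exact h
      | lhdInv s t ihs iht =>
        have h := g.map_act (x := FreeRack.mk t) (y := FreeRack.mk t ◃⁻¹ FreeRack.mk s)
        rw [Rack.act_invAct_eq, ihs, iht] at h
        rw [RackTerm.eval, h, Rack.invAct_act_eq]
        rfl
    ext x
    induction x using Quotient.inductionOn with
    | _ t => exact key t

/-- The free rack on `n` generators as an object of the category of racks. -/
abbrev freeRack (n : ℕ) : RackCat.{u} :=
  RackCat.of (FreeRack.{u} n)

/-- The covariant isotropy group of `M`: natural automorphisms of the projection
`M / Rack ⥤ Rack`. -/
abbrev IsotropyGroup (M : RackCat.{u}) :=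
  Aut (Under.forget M)

/-- The family of endomorphisms `π`, indexed by the morphisms `h` with domain `M`, is (the family of
components of) an element of the isotropy group of `M`. -/
def IsIsotropy {M : RackCat.{u}} (π : ∀ (S : RackCat.{u}), (M ⟶ S) → (S ⟶ S)) : Prop :=
  ∃ α : IsotropyGroup M, ∀ (S : RackCat.{u}) (h : M ⟶ S), π S h = α.hom.app (Under.mk h)

/-- `h` is a categorical inner automorphism of `M`: the component at the identity of `M` of an
element of the isotropy group. -/
def IsCategoricalInner {M : RackCat.{u}} (h : M ⟶ M) : Prop :=
  ∃ α : IsotropyGroup M, h = α.hom.app (Under.mk (𝟙 M))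

/-- Reduced group words in `y₁, …, y_n`; the letter `(i, true)` is `y_i` and `(i, false)` is its
inverse. -/
abbrev ReducedWord (n : ℕ) :=
  {w : List (Fin n × Bool) // FreeGroup.IsReduced w}

end RackIsotropy

/-! The free group on the generators acts on the free rack from the right (`transport`), and every
element of the free rack is a generator moved by a group element. By naturality, an isotropy element
is determined by its value at a newly adjoined generator, hence by one generator and one group
element `g` in `n + 1` letters. Surjectivity of the components forces that generator to be the new
one, `x`.

Since the components are rack endomorphisms, comparing them on `r`, `s` and `r ◃ s` for two new
generators `r` and `s` gives `x * k' = k' * (g⁻¹ * x * g)`, where `k'` is `g` with `x` erased. So `g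
* k'⁻¹` centralizes `x`, hence is a power of `x`, and `g = x ^ z * k'`: a self-power followed by a
word in the old generators. Equations are carried from racks to groups by `ConjRack`. Conversely,
self-powers are natural automorphisms, and so are the right actions of words in the images of the
generators. -/

/-! ### Centralizers of generators in free groups. -/

namespace FreeGroup

variable {ι : Type*}

/-- A reduced word with a letter other than `x` in front stays reduced when `x` is prepended. -/
theorem IsReduced.cons_of_head_ne {x : ι} {b : Bool} {L : List (ι × Bool)} (hL : IsReduced L)
    (h : ∀ p ∈ L.head?, p.1 ≠ x) : IsReduced ((x, b) :: L) := by
  cases L with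
  | nil => exact IsReduced.singleton
  | cons p L =>
    rw [isReduced_cons_cons]
    exact ⟨fun hp => absurd hp.symm (h p rfl), hL⟩

/-- The centralizer of a free generator consists of its powers. -/
theorem exists_zpow_of_commute_of (x : ι) (c : FreeGroup ι) (h : Commute c (of x)) :
    ∃ z : ℤ, c = of x ^ z := by
  classical
  induction hn : c.toWord.length using Nat.strong_induction_on generalizing c with
  | _ n ih =>
  have hletter : ∀ b : Bool, ∃ z : ℤ, mk [(x, b)] = of x ^ z := by
    rintro (_ | _)
    · exact ⟨-1, by rw [zpow_neg_one]; rfl⟩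
    · exact ⟨1, by rw [zpow_one]; rfl⟩
  have hred : IsReduced c.toWord := isReduced_toWord
  have hc : mk c.toWord = c := mk_toWord
  -- A letter `x` or its inverse at either end is stripped off. If neither end has one and the word
  -- is nonempty, then `x * c` and `c * x` are both reduced as written, and their first letters
  -- differ.
  by_cases hhead : ∀ p ∈ c.toWord.head?, p.1 ≠ x
  · rcases List.eq_nil_or_concat c.toWord with hnil | ⟨L, q, hq⟩
    · exact ⟨0, by rw [zpow_zero, ← toWord_eq_nil_iff, hnil]⟩
    by_cases hlast : q.1 = x
    · obtain ⟨z, hz⟩ := hletter q.2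
      have hcq : c = mk L * of x ^ z := by
        rw [← hz, mul_mk, ← hc, hq]
        simp [← hlast]
      have hL : IsReduced L := hred.infix ⟨[], [q], by simp [hq]⟩
      have hcomm : Commute (mk L) (of x) := by
        have : mk L = c * (of x ^ z)⁻¹ := by rw [hcq]; group
        rw [this]
        exact h.mul_left (((Commute.refl (of x)).zpow_left z).inv_left)
      obtain ⟨z', hz'⟩ := ih L.length (by rw [← hn, hq]; simp) _ hcomm
        (by rw [toWord_mk, hL.reduce_eq])
      exact ⟨z' + z, by rw [hcq, hz', zpow_add]⟩
    · have h₁ : (of x * c).toWord = (x, true) :: c.toWord := by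
        rw [toWord_mul, toWord_of, List.singleton_append,
          (hred.cons_of_head_ne hhead).reduce_eq]
      have h₂ : (c * of x).toWord = c.toWord ++ [(x, true)] := by
        rw [toWord_mul, toWord_of]
        refine IsReduced.reduce_eq ?_
        rw [IsReduced, List.isChain_append]
        refine ⟨hred, List.isChain_singleton _, ?_⟩
        intro a ha b hb hab
        simp [hq] at ha hb
        subst ha hb
        exact absurd hab hlast
      rw [h.eq, h₁] at h₂
      cases hw : c.toWord with
      | nil => simp [hw] at hq
      | cons p L' =>
        rw [hw] at h₂ hhead
        exact absurd (by simp at h₂; rw [← h₂.1]) (hhead p rfl)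
  · push Not at hhead
    obtain ⟨p, hp, hpx⟩ := hhead
    obtain ⟨L, hL⟩ : ∃ L, c.toWord = p :: L := by
      cases hw : c.toWord with
      | nil => simp [hw] at hp
      | cons q L => simp [hw] at hp; exact ⟨L, by rw [hp]⟩
    obtain ⟨z, hz⟩ := hletter p.2
    have hcp : c = of x ^ z * mk L := by
      rw [← hz, mul_mk, ← hc, hL]
      simp [← hpx]
    have hLr : IsReduced L := hred.infix ⟨[p], [], by simp [hL]⟩
    have hcomm : Commute (mk L) (of x) := by
      have : mk L = (of x ^ z)⁻¹ * c := by rw [hcp]; group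
      rw [this]
      exact (((Commute.refl (of x)).zpow_left z).inv_left).mul_left h
    obtain ⟨z', hz'⟩ := ih L.length (by rw [← hn, hL]; simp) _ hcomm
      (by rw [toWord_mk, hLr.reduce_eq])
    exact ⟨z + z', by rw [hcp, hz', zpow_add]⟩

theorem zpow_of_injective (x : ι) : Function.Injective fun z : ℤ => of x ^ z := by
  intro z z' h
  have := congrArg (lift fun _ : ι => Multiplicative.ofAdd (1 : ℤ)) h
  simp only [map_zpow, lift_apply_of] at this
  simpa [← ofAdd_zsmul] using this

end FreeGroup

/-! ### The right action of a free group, and inner endomorphisms of racks. -/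

namespace Rack

variable {R S : Type*} [Rack R] [Rack S] {ι κ : Type*}

theorem map_invAct (f : R →◃ S) (x y : R) : f (x ◃⁻¹ y) = f x ◃⁻¹ f y := by
  rw [← left_cancel (f x), ← f.map_act, act_invAct_eq, act_invAct_eq]

/-- The homomorphism from a free group to the permutations of a rack through which the generator
`i` acts by the inverse of `a i`. -/
def invAction (a : ι → R) : FreeGroup ι →* Equiv.Perm R :=
  FreeGroup.lift fun i => (act' (a i))⁻¹

/-- The right action of the free group on a rack: a word acts letter by letter, from left to
right. -/
def transport (a : ι → R) (g : FreeGroup ι) : Equiv.Perm R :=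
  -- The two inversions cancel on generators, which act by `act'`, and turn the homomorphism into an
  -- antihomomorphism.
  (invAction a g)⁻¹

theorem transport_one (a : ι → R) : transport a 1 = 1 := by
  simp [transport]

theorem transport_mul (a : ι → R) (g h : FreeGroup ι) :
    transport a (g * h) = transport a h * transport a g := by
  simp [transport]

theorem transport_inv (a : ι → R) (g : FreeGroup ι) :
    transport a g⁻¹ = (transport a g)⁻¹ := by
  simp [transport]

theorem transport_zpow (a : ι → R) (g : FreeGroup ι) (z : ℤ) :
    transport a (g ^ z) = transport a g ^ z := by
  simp [transport]

theorem transport_of (a : ι → R) (i : ι) : transport a (.of i) = act' (a i) := by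
  simp [transport, invAction]

theorem transport_map (a : κ → R) (e : ι → κ) (g : FreeGroup ι) :
    transport a (FreeGroup.map e g) = transport (a ∘ e) g := by
  have : (invAction a).comp (FreeGroup.map e) = invAction (a ∘ e) := by
    ext i : 1
    simp [invAction]
  simp [transport, ← this]

theorem map_transport (f : R →◃ S) (a : ι → R) (g : FreeGroup ι) (x : R) :
    f (transport a g x) = transport (f ∘ a) g (f x) := by
  induction g using FreeGroup.induction_on generalizing x with
  | C1 => simp [transport_one]
  | of i => simp [transport_of, f.map_act]
  | inv_of i _ =>
    rw [transport_inv, transport_inv, transport_of, transport_of, invAct_apply, invAct_apply,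
      map_invAct, Function.comp]
  | mul g h hg hh => simp only [transport_mul, Equiv.Perm.mul_apply, hg, hh]

/-- Each letter acts by a rack automorphism, and automorphisms conjugate the action of an element
into the action of its image. -/
theorem act'_transport (a : ι → R) (g : FreeGroup ι) (x : R) :
    act' (transport a g x) = transport a g * act' x * (transport a g)⁻¹ := by
  induction g using FreeGroup.induction_on generalizing x with
  | C1 => simp [transport_one]
  | of i => rw [transport_of, act'_apply, ad_conj]
  | inv_of i _ =>
    have := ad_conj (a i) (a i ◃⁻¹ x)
    rw [act_invAct_eq] at this
    rw [transport_inv, transport_of, invAct_apply, this]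
    group
  | mul g h hg hh =>
    rw [transport_mul, Equiv.Perm.mul_apply, hh, hg]
    group

theorem transport_act (a : ι → R) (g : FreeGroup ι) (x y : R) :
    transport a g (x ◃ y) = transport a g x ◃ transport a g y := by
  rw [← act'_apply, ← act'_apply, act'_transport]
  simp

/-- The action is conjugated by a power of itself, so it does not change. This makes self-powers
endomorphisms. -/
theorem act'_zpow_self (x : R) (z : ℤ) : act' ((act' x ^ z) x) = act' x := by
  have h : act' x ^ z = transport (fun _ : Unit => x) (.of () ^ z) := by
    rw [transport_zpow, transport_of]
  rw [h, act'_transport, ← h]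
  group

theorem zpow_self_act (x y : R) (z : ℤ) :
    (act' (x ◃ y) ^ z) (x ◃ y) = (act' x ^ z) x ◃ (act' y ^ z) y := by
  rw [← act'_apply ((act' x ^ z) x), act'_zpow_self, ad_conj, conj_zpow]
  simp

/-- The self-power `r ↦ r ◁^{±1} r ⋯ ◁^{±1} r` with `z` operations, followed by the right action
of `g`, as a rack homomorphism. -/
def innerHom (a : ι → R) (z : ℤ) (g : FreeGroup ι) : R →◃ R where
  toFun r := transport a g ((act' r ^ z) r)
  map_act' {x y} := by rw [zpow_self_act, transport_act]

theorem innerHom_apply (a : ι → R) (z : ℤ) (g : FreeGroup ι) (r : R) :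
    innerHom a z g r = transport a g ((act' r ^ z) r) := rfl

theorem map_innerHom (f : R →◃ S) (a : ι → R) (z : ℤ) (g : FreeGroup ι) (r : R) :
    f (innerHom a z g r) = innerHom (f ∘ a) z g (f r) := by
  -- The self-power is written as a `transport` along a one-element family, so that `map_transport`
  -- applies to it as well.
  have h (r : R) : act' r ^ z = transport (fun _ : Unit => r) (.of () ^ z) := by
    rw [transport_zpow, transport_of]
  have h' (s : S) : act' s ^ z = transport (fun _ : Unit => s) (.of () ^ z) := by
    rw [transport_zpow, transport_of]
  rw [innerHom_apply, innerHom_apply, map_transport, h, map_transport, h']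
  rfl

theorem innerHom_comp_inv (a : ι → R) (z : ℤ) (g : FreeGroup ι) (r : R) :
    innerHom a z g (innerHom a (-z) g⁻¹ r) = r := by
  rw [innerHom_apply a z, innerHom_apply a (-z), act'_transport, act'_zpow_self, transport_inv,
    conj_zpow, ← Equiv.Perm.mul_apply, ← Equiv.Perm.mul_apply, ← Equiv.Perm.mul_apply]
  convert Equiv.Perm.one_apply r
  group

theorem innerHom_inv_comp (a : ι → R) (z : ℤ) (g : FreeGroup ι) (r : R) :
    innerHom a (-z) g⁻¹ (innerHom a z g r) = r := by
  simpa using innerHom_comp_inv a (-z) g⁻¹ r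

end Rack

/-! ### Test racks built from groups. -/

/-- The rack `G × X` attached to a map `φ` from `X` to a group `G`, in which `(h, y)` acts on
`(g, x)` by right multiplication of `g` with `h⁻¹ φ(y) h`. -/
@[ext]
structure ConjRack {G X : Type*} (φ : X → G) where
  elt : G
  index : X

namespace ConjRack

variable {G X : Type*} [Group G] {φ : X → G}

instance : Rack (ConjRack φ) where
  act p q := ⟨q.elt * (p.elt⁻¹ * φ p.index * p.elt), q.index⟩
  invAct p q := ⟨q.elt * (p.elt⁻¹ * φ p.index * p.elt)⁻¹, q.index⟩
  self_distrib {p q r} := by ext <;> simp [mul_assoc]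
  left_inv p q := by ext <;> simp [mul_assoc]
  right_inv p q := by ext <;> simp [mul_assoc]

theorem act_def (p q : ConjRack φ) :
    p ◃ q = ⟨q.elt * (p.elt⁻¹ * φ p.index * p.elt), q.index⟩ := rfl

theorem invAct_def (p q : ConjRack φ) :
    p ◃⁻¹ q = ⟨q.elt * (p.elt⁻¹ * φ p.index * p.elt)⁻¹, q.index⟩ := rfl

/-- The index records the starting generator and the group component records the acting word; the
two are detected separately. -/
theorem transport_apply {ι : Type*} (a : ι → ConjRack φ) (g : FreeGroup ι) (p : ConjRack φ) :
    Rack.transport a g p =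
      ⟨p.elt * FreeGroup.lift (fun i => (a i).elt⁻¹ * φ (a i).index * (a i).elt) g, p.index⟩ := by
  induction g using FreeGroup.induction_on generalizing p with
  | C1 => simp [Rack.transport_one]
  | of i => simp [Rack.transport_of, act_def]
  | inv_of i _ => rw [Rack.transport_inv, Rack.transport_of, Rack.invAct_apply]; simp [invAct_def]
  | mul g h hg hh => simp [Rack.transport_mul, hg, hh, mul_assoc]

theorem innerHom_one_apply {ι : Type*} (e : ι → X) (z : ℤ) (g : FreeGroup ι) (x : X) :
    Rack.innerHom (fun i => (⟨1, e i⟩ : ConjRack φ)) z g ⟨1, x⟩ =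
      ⟨φ x ^ z * FreeGroup.lift (φ ∘ e) g, x⟩ := by
  have h : Rack.act' (⟨1, x⟩ : ConjRack φ) ^ z =
      Rack.transport (fun _ : Unit => (⟨1, x⟩ : ConjRack φ)) (.of () ^ z) := by
    rw [Rack.transport_zpow, Rack.transport_of]
  rw [Rack.innerHom_apply, h, transport_apply, transport_apply]
  simp [Function.comp_def]

end ConjRack

/-! ### Iterated operations as group actions. -/

namespace RackIsotropy

open Rack

section Values

variable {R : Type*} [Rack R]

theorem lhdPow_eq_transport {ι : Type*} (a : ι → R) (x : R) (i : ι) (b : Bool) :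
    lhdPow x b (a i) = transport a (FreeGroup.mk [(i, b)]) x := by
  cases b with
  | true =>
    change _ = transport a (FreeGroup.of i) x
    rw [transport_of]
    rfl
  | false =>
    change _ = transport a (FreeGroup.of i)⁻¹ x
    rw [transport_inv, transport_of]
    rfl

theorem iterWord_map {ι : Type*} (a : ι → R) (x : R) (w : List (ι × Bool)) :
    iterWord x (w.map fun p => (a p.1, p.2)) = transport a (FreeGroup.mk w) x := by
  induction w generalizing x with
  | nil =>
    change x = transport a 1 x
    rw [transport_one, Equiv.Perm.one_apply]
  | cons p w ih =>
    have h : FreeGroup.mk (p :: w) = FreeGroup.mk [p] * FreeGroup.mk w := by simp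
    rw [h, transport_mul, Equiv.Perm.mul_apply, ← ih, ← lhdPow_eq_transport a x p.1 p.2]
    rfl

/-- Iterated operations by one fixed element amount to an integer power of its action; the exponent
only depends on the signs. -/
theorem exists_iterSelf_eq_zpow (δ : List Bool) :
    ∃ z : ℤ, ∀ {R : Type*} [Rack R] (x r : R), iterSelf x r δ = (act' r ^ z) x := by
  induction δ with
  | nil => exact ⟨0, fun x r => rfl⟩
  | cons d δ ih =>
    obtain ⟨z, hz⟩ := ih
    cases d with
    | true => exact ⟨z + 1, fun x r => by rw [zpow_add_one]; exact hz _ r⟩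
    | false => exact ⟨z - 1, fun x r => by rw [zpow_sub_one]; exact hz _ r⟩

theorem iterSelf_replicate_true (x r : R) (k : ℕ) :
    iterSelf x r (List.replicate k true) = (act' r ^ k) x := by
  induction k generalizing x with
  | zero => rfl
  | succ k ih => rw [pow_succ]; exact ih _

theorem iterSelf_replicate_false (x r : R) (k : ℕ) :
    iterSelf x r (List.replicate k false) = ((act' r)⁻¹ ^ k) x := by
  induction k generalizing x with
  | zero => rfl
  | succ k ih => rw [pow_succ]; exact ih _

theorem iterSelf_replicate_sign (x r : R) (z : ℤ) :
    iterSelf x r (List.replicate z.natAbs (decide (0 < z))) = (act' r ^ z) x := by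
  by_cases hz : 0 < z
  · lift z to ℕ using hz.le
    rw [decide_eq_true hz, iterSelf_replicate_true, zpow_natCast, Int.natAbs_natCast]
  -- The case `z = 0` falls here; the list is then empty and its sign is irrelevant.
  · obtain ⟨k, rfl⟩ : ∃ k : ℕ, z = -k := ⟨z.natAbs, by lia⟩
    rw [decide_eq_false hz, iterSelf_replicate_false, zpow_neg, zpow_natCast, inv_pow,
      Int.natAbs_neg, Int.natAbs_natCast]

theorem canonicalValue_eq_innerHom {n : ℕ} (a : Fin n → R) (z : ℤ) (w : List (Fin n × Bool))
    (r : R) : canonicalValue a z w r = innerHom a z (FreeGroup.mk w) r := by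
  rw [canonicalValue, iterWord_map, iterSelf_replicate_sign, innerHom_apply]

end Values

/-! ### Elements of the free rack as translates of generators. -/

namespace FreeRack

variable {n : ℕ} {S : Type*} [Rack S]

/-- The homomorphism from the free rack with prescribed values on the generators. -/
noncomputable def lift (a : Fin n → S) : FreeRack.{u} n →◃ S :=
  (existsUnique_hom a).choose

@[simp]
theorem lift_gen (a : Fin n → S) (i : Fin n) : lift.{u} a (gen i) = a i :=
  (existsUnique_hom a).choose_spec.1 i

theorem hom_ext {f g : FreeRack.{u} n →◃ S} (h : ∀ i, f (gen i) = g (gen i)) : f = g :=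
  (existsUnique_hom fun i => g (gen i)).unique h fun _ => rfl

theorem lift_comp_gen (a : Fin n → S) : lift.{u} a ∘ gen = a :=
  funext (lift_gen a)

/-- Every element of the free rack arises from a generator by the right action of the free group on
the generators. -/
theorem exists_eq_transport (x : FreeRack.{u} n) :
    ∃ (i : Fin n) (g : FreeGroup (Fin n)), x = transport gen g (gen i) := by
  induction x using Quotient.inductionOn with
  | _ t =>
    induction t with
    | gen i => exact ⟨i, 1, by rw [transport_one]; rfl⟩
    | lhd s t hs ht =>
      obtain ⟨i, g, hs⟩ := hs
      obtain ⟨j, k, ht⟩ := ht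
      -- By `act'_transport`, the translate of the generator `j` by `k` acts as this conjugate of
      -- `j`.
      refine ⟨i, g * (k⁻¹ * .of j * k), ?_⟩
      change mk t ◃ mk s = _
      change mk s = _ at hs
      change mk t = _ at ht
      rw [hs, ht, ← act'_apply, act'_transport]
      simp only [transport_mul, transport_inv, transport_of, Equiv.Perm.mul_apply]
    | lhdInv s t hs ht =>
      obtain ⟨i, g, hs⟩ := hs
      obtain ⟨j, k, ht⟩ := ht
      refine ⟨i, g * (k⁻¹ * (.of j)⁻¹ * k), ?_⟩
      change mk t ◃⁻¹ mk s = _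
      change mk s = _ at hs
      change mk t = _ at ht
      rw [hs, ht, ← invAct_apply, act'_transport]
      simp only [transport_mul, transport_inv, transport_of, Equiv.Perm.mul_apply, mul_inv_rev,
        inv_inv]

theorem exists_act'_eq_transport (x : FreeRack.{u} n) :
    ∃ g : FreeGroup (Fin n), act' x = transport gen g := by
  obtain ⟨i, g, rfl⟩ := exists_eq_transport x
  refine ⟨g⁻¹ * .of i * g, ?_⟩
  simp only [act'_transport, transport_mul, transport_inv, transport_of, mul_assoc]

/-- Arbitrary acting elements can be replaced by words in the generators, which is why algebraic
inner automorphisms are no more general than the canonical ones. -/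
theorem exists_iterWord_eq_transport (w : List (FreeRack.{u} n × Bool)) :
    ∃ g : FreeGroup (Fin n), ∀ x : FreeRack.{u} n, iterWord x w = transport gen g x := by
  induction w with
  | nil => exact ⟨1, fun x => by rw [transport_one]; rfl⟩
  | cons p w ih =>
    obtain ⟨g, hg⟩ := ih
    obtain ⟨r, b⟩ := p
    obtain ⟨k, hk⟩ := exists_act'_eq_transport r
    cases b with
    | true =>
      refine ⟨k * g, fun x => ?_⟩
      rw [transport_mul, Equiv.Perm.mul_apply, ← hk]
      exact hg _
    | false =>
      refine ⟨k⁻¹ * g, fun x => ?_⟩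
      rw [transport_mul, Equiv.Perm.mul_apply, transport_inv, ← hk]
      exact hg _

theorem lift_transport_gen (a : Fin n → S) (g : FreeGroup (Fin n)) (x : FreeRack.{u} n) :
    lift a (transport gen g x) = transport a g (lift a x) := by
  rw [map_transport, lift_comp_gen]

end FreeRack

theorem RackCat.hom_ext {A B : RackCat.{u}} {f g : A ⟶ B} (h : ∀ x : A, f x = g x) : f = g :=
  ShelfHom.ext (funext h)

/-- The isomorphism of racks whose underlying map is `Rack.innerHom`. -/
def innerIso {ι : Type*} (S : RackCat.{u}) (a : ι → S) (z : ℤ) (g : FreeGroup ι) : S ≅ S where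
  hom := innerHom a z g
  inv := innerHom a (-z) g⁻¹
  hom_inv_id := RackCat.hom_ext fun r => innerHom_inv_comp a z g r
  inv_hom_id := RackCat.hom_ext fun r => innerHom_comp_inv a z g r

/-- The element of the isotropy group of the free rack given by the maps `Rack.innerHom`. -/
def isotropyOf {n : ℕ} (z : ℤ) (g : FreeGroup (Fin n)) : IsotropyGroup (freeRack.{u} n) :=
  NatIso.ofComponents (fun U => innerIso U.right (fun i => U.hom (FreeRack.gen i)) z g) (by
    intro U V f
    refine RackCat.hom_ext fun r => ?_
    have h : (fun i => V.hom (FreeRack.gen i)) = f.right ∘ fun i => U.hom (FreeRack.gen i) := by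
      rw [← Under.w f]
      rfl
    change innerHom (fun i => V.hom (FreeRack.gen i)) z g (f.right r) =
      f.right (innerHom (fun i => U.hom (FreeRack.gen i)) z g r)
    rw [h]
    exact (map_innerHom f.right _ z g r).symm)

theorem app_naturality {n : ℕ} (α : IsotropyGroup (freeRack.{u} n)) {S T : RackCat.{u}}
    (h : freeRack.{u} n ⟶ S) (f : S ⟶ T) (k : freeRack.{u} n ⟶ T) (hk : h ≫ f = k) (r : S) :
    α.hom.app (Under.mk k) (f r) = f (α.hom.app (Under.mk h) r) := by
  have := α.hom.naturality (Under.homMk f hk : Under.mk h ⟶ Under.mk k)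
  exact congrArg (fun q : S →◃ T => q r) this

/-- The action of the canonical maps on the generators of the free rack, computed in `ConjRack`. -/
theorem lift_innerHom_gen {m n : ℕ} {G : Type*} [Group G] (φ : Fin n → G) (e : Fin m → Fin n)
    (z : ℤ) (g : FreeGroup (Fin m)) (i : Fin n) :
    FreeRack.lift (fun j => (⟨1, j⟩ : ConjRack φ))
        (innerHom (fun j => FreeRack.gen.{u} (e j)) z g (FreeRack.gen i)) =
      ⟨φ i ^ z * FreeGroup.lift (φ ∘ e) g, i⟩ := by
  rw [map_innerHom, FreeRack.lift_gen, ← ConjRack.innerHom_one_apply]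
  congr
  funext j
  exact FreeRack.lift_gen _ _

/-- A free group element in `n + 1` generators which is compatible with the rack operation in its
last generator is a power of that generator times an element in the other generators. -/
theorem exists_eq_zpow_mul_map {n : ℕ} (g : FreeGroup (Fin (n + 1)))
    (h : FreeGroup.of (Fin.last n) *
          FreeGroup.map Fin.castSucc (FreeGroup.lift (Fin.snoc FreeGroup.of 1) g) =
        FreeGroup.map Fin.castSucc (FreeGroup.lift (Fin.snoc FreeGroup.of 1) g) *
          (g⁻¹ * FreeGroup.of (Fin.last n) * g)) :
    ∃ (z : ℤ) (k : FreeGroup (Fin n)),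
      g = FreeGroup.of (Fin.last n) ^ z * FreeGroup.map Fin.castSucc k := by
  set k := FreeGroup.lift (Fin.snoc FreeGroup.of 1) g
  set x := FreeGroup.of (Fin.last n)
  set k' := FreeGroup.map Fin.castSucc k
  -- The hypothesis says that conjugation by `k'` takes `g⁻¹ * x * g` back to `x`.
  obtain ⟨z, hz⟩ := FreeGroup.exists_zpow_of_commute_of (Fin.last n) (g * k'⁻¹) (by
    change g * k'⁻¹ * x = x * (g * k'⁻¹)
    have hx : x = k' * (g⁻¹ * x * g) * k'⁻¹ := by rw [← h]; group
    calc g * k'⁻¹ * x = g * k'⁻¹ * (k' * (g⁻¹ * x * g) * k'⁻¹) := by rw [← hx]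
      _ = x * (g * k'⁻¹) := by group)
  exact ⟨z, k, by rw [← hz, inv_mul_cancel_right]⟩

/-! ### The canonical form of isotropy elements. -/

section Isotropy

variable {n : ℕ} (α : IsotropyGroup (freeRack.{u} n))

/-- The free rack morphism that adjoins a new generator. -/
noncomputable def adjoinGen (n : ℕ) : freeRack.{u} n ⟶ freeRack.{u} (n + 1) :=
  FreeRack.lift fun i => FreeRack.gen i.castSucc

theorem adjoinGen_gen (i : Fin n) :
    adjoinGen.{u} n (FreeRack.gen i) = FreeRack.gen i.castSucc :=
  FreeRack.lift_gen _ _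

/-- An element of the isotropy group is determined by its value at the generic element. -/
theorem app_eq_lift {S : RackCat.{u}} (h : freeRack.{u} n ⟶ S) (r : S) :
    α.hom.app (Under.mk h) r =
      FreeRack.lift (Fin.snoc (α := fun _ => S) (fun i => h (FreeRack.gen i)) r)
        (α.hom.app (Under.mk (adjoinGen n)) (FreeRack.gen (Fin.last n))) := by
  have := app_naturality α (adjoinGen n)
    (FreeRack.lift (Fin.snoc (α := fun _ => S) (fun i => h (FreeRack.gen i)) r)) h
    (FreeRack.hom_ext fun i => by
      change FreeRack.lift _ (adjoinGen n (FreeRack.gen i)) = _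
      rw [adjoinGen_gen, FreeRack.lift_gen, Fin.snoc_castSucc]
      rfl) (FreeRack.gen (Fin.last n))
  refine Eq.trans (congrArg _ ?_) this
  exact ((FreeRack.lift_gen _ _).trans (Fin.snoc_last _ _)).symm

theorem exists_app_eq_transport :
    ∃ (k : Fin (n + 1)) (g : FreeGroup (Fin (n + 1))),
      ∀ {S : RackCat.{u}} (h : freeRack.{u} n ⟶ S) (r : S),
        α.hom.app (Under.mk h) r =
          transport (Fin.snoc (α := fun _ => S) (fun i => h (FreeRack.gen i)) r) g
            (Fin.snoc (α := fun _ => S) (fun i => h (FreeRack.gen i)) r k) := by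
  obtain ⟨k, g, hg⟩ := FreeRack.exists_eq_transport
    (α.hom.app (Under.mk (adjoinGen n)) (FreeRack.gen (Fin.last n)) : FreeRack.{u} (n + 1))
  refine ⟨k, g, fun h r => ?_⟩
  rw [app_eq_lift]
  refine (congrArg _ hg).trans ?_
  rw [FreeRack.lift_transport_gen, FreeRack.lift_gen]

theorem app_surjective {S : RackCat.{u}} (h : freeRack.{u} n ⟶ S) (s : S) :
    ∃ r : S, α.hom.app (Under.mk h) r = s :=
  ⟨α.inv.app (Under.mk h) s,
    congrArg (fun q : S →◃ S => q s) (α.inv_hom_id_app (Under.mk h))⟩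

/-- If the generator were an old one, all values of the component at `adjoinGen n` would lie in its
orbit, and the new generator would be missed. -/
theorem exists_app_eq_transport_self :
    ∃ g : FreeGroup (Fin (n + 1)),
      ∀ {S : RackCat.{u}} (h : freeRack.{u} n ⟶ S) (r : S),
        α.hom.app (Under.mk h) r =
          transport (Fin.snoc (α := fun _ => S) (fun i => h (FreeRack.gen i)) r) g r := by
  obtain ⟨k, g, hg⟩ := exists_app_eq_transport α
  cases k using Fin.lastCases with
  | last =>
    refine ⟨g, fun h r => ?_⟩
    rw [hg, Fin.snoc_last]
  | cast j =>
    obtain ⟨r, hr⟩ := app_surjective α (adjoinGen n) (FreeRack.gen (Fin.last n))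
    rw [hg, Fin.snoc_castSucc, adjoinGen_gen] at hr
    -- Only the index matters here, so a trivial `φ` suffices.
    have := congrArg (fun x => (FreeRack.lift
      (fun i => (⟨1, i⟩ : ConjRack fun _ : Fin (n + 1) => (1 : Multiplicative ℤ))) x).index) hr
    simp only [map_transport, ConjRack.transport_apply, FreeRack.lift_gen] at this
    exact absurd this (Fin.castSucc_ne_last j)

theorem exists_app_eq_innerHom :
    ∃ (z : ℤ) (g : FreeGroup (Fin n)),
      ∀ {S : RackCat.{u}} (h : freeRack.{u} n ⟶ S) (r : S),
        α.hom.app (Under.mk h) r = innerHom (fun i => h (FreeRack.gen i)) z g r := by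
  obtain ⟨g, hg⟩ := exists_app_eq_transport_self α
  obtain ⟨z, k, rfl⟩ := exists_eq_zpow_mul_map g (by
    let h : freeRack.{u} n ⟶ freeRack.{u} (n + 2) := adjoinGen n ≫ adjoinGen (n + 1)
    have hgen (i : Fin n) : h (FreeRack.gen i) = FreeRack.gen i.castSucc.castSucc :=
      (congrArg (adjoinGen (n + 1)) (adjoinGen_gen i)).trans (adjoinGen_gen _)
    let r : FreeRack.{u} (n + 2) := FreeRack.gen (Fin.last n).castSucc
    let s : FreeRack.{u} (n + 2) := FreeRack.gen (Fin.last (n + 1))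
    -- The label `1` makes `s` act trivially, so evaluating at `s` or `r ◃ s` erases the last letter
    -- of `g`, while evaluating at `r` keeps it.
    let φ : Fin (n + 2) → FreeGroup (Fin (n + 1)) :=
      Fin.snoc (α := fun _ => FreeGroup (Fin (n + 1))) FreeGroup.of 1
    let F : FreeRack.{u} (n + 2) →◃ ConjRack φ := FreeRack.lift fun i => ⟨1, i⟩
    obtain ⟨A, hA⟩ : ∃ A : FreeRack.{u} (n + 2) →◃ FreeRack.{u} (n + 2), ∀ t, A t =
        transport (Fin.snoc (α := fun _ => FreeRack.{u} (n + 2))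
          (fun i => h (FreeRack.gen i)) t) g t := ⟨α.hom.app (Under.mk h), hg h⟩
    have hF (t : FreeRack.{u} (n + 2)) :
        F (A t) = ⟨(F t).elt * FreeGroup.lift
          (Fin.snoc (α := fun _ => FreeGroup (Fin (n + 1)))
            (fun i => FreeGroup.of i.castSucc)
            ((F t).elt⁻¹ * φ (F t).index * (F t).elt)) g, (F t).index⟩ := by
      rw [hA, map_transport, ConjRack.transport_apply]
      congr
      funext i
      cases i using Fin.lastCases with
      | last => simp
      | cast i => simp [hgen, F, φ]
    have hr : F r = ⟨1, (Fin.last n).castSucc⟩ := FreeRack.lift_gen _ _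
    have hs : F s = ⟨1, Fin.last (n + 1)⟩ := FreeRack.lift_gen _ _
    have hφr : φ (Fin.last n).castSucc = FreeGroup.of (Fin.last n) := Fin.snoc_castSucc _ _ _
    have hφs : φ (Fin.last (n + 1)) = 1 := Fin.snoc_last _ _
    have hrs : F (r ◃ s) = ⟨FreeGroup.of (Fin.last n), Fin.last (n + 1)⟩ := by
      rw [F.map_act, hr, hs, ConjRack.act_def, hφr]
      simp
    have h1 : FreeGroup.lift (Fin.snoc (α := fun _ => FreeGroup (Fin (n + 1)))
        (fun i => FreeGroup.of i.castSucc) (FreeGroup.of (Fin.last n))) g = g := by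
      have : FreeGroup.lift (Fin.snoc (α := fun _ => FreeGroup (Fin (n + 1)))
          (fun i => FreeGroup.of i.castSucc) (FreeGroup.of (Fin.last n))) = MonoidHom.id _ := by
        ext i : 1
        cases i using Fin.lastCases <;> simp
      rw [this, MonoidHom.id_apply]
    have h2 : FreeGroup.lift (Fin.snoc (α := fun _ => FreeGroup (Fin (n + 1)))
        (fun i => FreeGroup.of i.castSucc) 1) g =
        FreeGroup.map Fin.castSucc (FreeGroup.lift (Fin.snoc FreeGroup.of 1) g) := by
      rw [← MonoidHom.comp_apply]
      congr 1
      ext i : 1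
      cases i using Fin.lastCases <;> simp
    have key : F (A (r ◃ s)) = F (A r) ◃ F (A s) := by rw [← F.map_act, A.map_act]
    rw [hF, hF, hF, hrs, hr, hs, ConjRack.act_def] at key
    simp only [hφr, hφs, mul_one, one_mul, inv_one, inv_mul_cancel, h1, h2] at key
    exact congrArg ConjRack.elt key)
  refine ⟨z, k, fun h r => ?_⟩
  rw [hg, transport_mul, transport_zpow, transport_of, transport_map, innerHom_apply,
    Fin.snoc_last, Equiv.Perm.mul_apply]
  congr 2
  funext i
  exact Fin.snoc_castSucc _ _ _

end Isotropy

/-! ### Uniqueness of the exponent and the word. -/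

/-- In the free group the value becomes `x ^ z * g` with `x` absent from `g`; erasing `x` recovers
`g`, and cancelling `g` recovers `z`. -/
theorem innerHom_generic_injective {n : ℕ} {z z' : ℤ} {g g' : FreeGroup (Fin n)}
    (h : innerHom (fun i => FreeRack.gen.{u} (Fin.castSucc i)) z g (FreeRack.gen (Fin.last n)) =
      innerHom (fun i => FreeRack.gen.{u} (Fin.castSucc i)) z' g' (FreeRack.gen (Fin.last n))) :
    z = z' ∧ g = g' := by
  have h := congrArg (FreeRack.lift fun j => (⟨1, j⟩ : ConjRack FreeGroup.of)) h
  rw [lift_innerHom_gen, lift_innerHom_gen] at h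
  have h := congrArg ConjRack.elt h
  have hlift (k : FreeGroup (Fin n)) :
      FreeGroup.lift (Fin.snoc FreeGroup.of 1)
        (FreeGroup.lift (FreeGroup.of ∘ Fin.castSucc) k) = k := by
    rw [← MonoidHom.comp_apply]
    conv_rhs => rw [← MonoidHom.id_apply _ k]
    congr 1
    ext i : 1
    simp
  have hg : g = g' := by
    have := congrArg (FreeGroup.lift (Fin.snoc FreeGroup.of 1)) h
    simpa [map_mul, map_zpow, hlift] using this
  subst hg
  exact ⟨FreeGroup.zpow_of_injective _ (mul_right_cancel h), rfl⟩

theorem innerHom_gen_injective {n : ℕ} (hn : 2 ≤ n) {z z' : ℤ} {g g' : FreeGroup (Fin n)}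
    (h : ∀ x : FreeRack.{u} n, innerHom FreeRack.gen z g x = innerHom FreeRack.gen z' g' x) :
    z = z' ∧ g = g' := by
  have key (i : Fin n) : FreeGroup.of i ^ z * g = FreeGroup.of i ^ z' * g' := by
    have h := congrArg (FreeRack.lift fun j => (⟨1, j⟩ : ConjRack FreeGroup.of)) (h (.gen i))
    have e := lift_innerHom_gen.{u} (FreeGroup.of (α := Fin n)) id
    simp only [id] at e
    rw [e, e, Function.comp_id, FreeGroup.lift_of_eq_id] at h
    exact congrArg ConjRack.elt h
  have hz : z = z' := by
    have hne : (⟨1, by lia⟩ : Fin n) ≠ ⟨0, by lia⟩ := by simp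
    -- Counting the exponent of generator `0` gives `z` plus that of `g` at generator `0`, but only
    -- that of `g` at generator `1`. A single generator would reveal only the sum.
    have h₀ := congrArg (FreeGroup.lift (Pi.mulSingle (⟨0, by lia⟩ : Fin n)
      (Multiplicative.ofAdd (1 : ℤ)))) (key ⟨0, by lia⟩)
    have h₁ := congrArg (FreeGroup.lift (Pi.mulSingle (⟨0, by lia⟩ : Fin n)
      (Multiplicative.ofAdd (1 : ℤ)))) (key ⟨1, by lia⟩)
    simp only [map_mul, map_zpow, FreeGroup.lift_apply_of, Pi.mulSingle_eq_same,
      Pi.mulSingle_eq_of_ne hne, one_zpow, one_mul] at h₀ h₁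
    rw [h₁] at h₀
    simpa [← ofAdd_zsmul] using mul_right_cancel h₀
  subst hz
  exact ⟨rfl, mul_left_cancel (key ⟨0, by lia⟩)⟩

namespace ReducedWord

variable {n : ℕ}

/-- The reduced word of an element of the free group. -/
def ofFreeGroup (g : FreeGroup (Fin n)) : ReducedWord n :=
  ⟨g.toWord, FreeGroup.isReduced_toWord⟩

theorem mk_ofFreeGroup (g : FreeGroup (Fin n)) : FreeGroup.mk (ofFreeGroup g).1 = g :=
  FreeGroup.mk_toWord

theorem mk_injective : Function.Injective fun w : ReducedWord n => FreeGroup.mk w.1 := by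
  intro w w' h
  have := congrArg FreeGroup.toWord h
  simp only [FreeGroup.toWord_mk, w.2.reduce_eq, w'.2.reduce_eq] at this
  exact Subtype.ext this

end ReducedWord

/-! ### The characterizations of inner automorphisms. -/

variable {n : ℕ}

theorem isIsotropy_iff_exists
    (π : ∀ S : RackCat.{u}, (freeRack.{u} n ⟶ S) → (S ⟶ S)) :
    IsIsotropy π ↔ ∃ p : ℤ × ReducedWord n, ∀ (S : RackCat.{u}) (h : freeRack.{u} n ⟶ S) (r : S),
      π S h r = canonicalValue (fun i => h (FreeRack.gen i)) p.1 p.2.1 r := by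
  simp only [canonicalValue_eq_innerHom]
  constructor
  · rintro ⟨α, hα⟩
    obtain ⟨z, g, hg⟩ := exists_app_eq_innerHom α
    refine ⟨(z, .ofFreeGroup g), fun S h r => ?_⟩
    rw [hα, ReducedWord.mk_ofFreeGroup]
    exact hg h r
  · rintro ⟨p, hp⟩
    exact ⟨isotropyOf p.1 (.mk p.2.1), fun S h => RackCat.hom_ext fun r => hp S h r⟩

theorem isIsotropy_iff_existsUnique
    (π : ∀ S : RackCat.{u}, (freeRack.{u} n ⟶ S) → (S ⟶ S)) :
    IsIsotropy π ↔ ∃! p : ℤ × ReducedWord n, ∀ (S : RackCat.{u}) (h : freeRack.{u} n ⟶ S) (r : S),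
      π S h r = canonicalValue (fun i => h (FreeRack.gen i)) p.1 p.2.1 r := by
  rw [isIsotropy_iff_exists]
  refine ⟨fun h => existsUnique_of_exists_of_unique h fun p q hp hq => ?_, ExistsUnique.exists⟩
  -- The generic element alone separates the pairs, so no bound on `n` is needed.
  have key := (hp _ (adjoinGen n) (FreeRack.gen (Fin.last n))).symm.trans
    (hq _ (adjoinGen n) (FreeRack.gen (Fin.last n)))
  have hval (z : ℤ) (w : List (Fin n × Bool)) :
      canonicalValue (fun i => (adjoinGen n (FreeRack.gen i) : FreeRack.{u} (n + 1))) z w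
        (FreeRack.gen (Fin.last n)) = innerHom (fun i => FreeRack.gen (Fin.castSucc i)) z
          (FreeGroup.mk w) (FreeRack.gen (Fin.last n)) := by
    rw [canonicalValue_eq_innerHom, funext adjoinGen_gen]
  obtain ⟨h₁, h₂⟩ := innerHom_generic_injective ((hval _ _).symm.trans (key.trans (hval _ _)))
  exact Prod.ext h₁ (ReducedWord.mk_injective h₂)

theorem isCategoricalInner_iff_exists (h : freeRack.{u} n ⟶ freeRack.{u} n) :
    IsCategoricalInner h ↔ ∃ p : ℤ × ReducedWord n, ∀ s : FreeRack.{u} n,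
      h s = canonicalValue FreeRack.gen p.1 p.2.1 s := by
  simp only [canonicalValue_eq_innerHom]
  constructor
  · rintro ⟨α, rfl⟩
    obtain ⟨z, g, hg⟩ := exists_app_eq_innerHom α
    refine ⟨(z, .ofFreeGroup g), fun s => ?_⟩
    rw [ReducedWord.mk_ofFreeGroup]
    exact hg (𝟙 _) s
  · rintro ⟨p, hp⟩
    exact ⟨isotropyOf p.1 (.mk p.2.1), RackCat.hom_ext fun s => hp s⟩

theorem isCategoricalInner_iff_existsUnique (hn : 2 ≤ n) (h : freeRack.{u} n ⟶ freeRack.{u} n) :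
    IsCategoricalInner h ↔ ∃! p : ℤ × ReducedWord n, ∀ s : FreeRack.{u} n,
      h s = canonicalValue FreeRack.gen p.1 p.2.1 s := by
  rw [isCategoricalInner_iff_exists]
  refine ⟨fun h => existsUnique_of_exists_of_unique h fun p q hp hq => ?_, ExistsUnique.exists⟩
  have key (s) := (hp s).symm.trans (hq s)
  simp only [canonicalValue_eq_innerHom] at key
  obtain ⟨h₁, h₂⟩ := innerHom_gen_injective hn key
  exact Prod.ext h₁ (ReducedWord.mk_injective h₂)

theorem isCategoricalInner_iff_isAlgebraicInner (h : freeRack.{u} n ⟶ freeRack.{u} n) :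
    IsCategoricalInner h ↔ IsAlgebraicInner fun s : FreeRack.{u} n => h s := by
  rw [isCategoricalInner_iff_exists]
  constructor
  · rintro ⟨p, hp⟩
    exact ⟨_, _, hp⟩
  · rintro ⟨δ, w, hw⟩
    obtain ⟨z, hz⟩ := exists_iterSelf_eq_zpow.{u} δ
    obtain ⟨g, hg⟩ := FreeRack.exists_iterWord_eq_transport w
    refine ⟨(z, .ofFreeGroup g), fun s => ?_⟩
    rw [canonicalValue_eq_innerHom, ReducedWord.mk_ofFreeGroup, innerHom_apply, ← hg, ← hz]
    exact hw s

end RackIsotropy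

theorem mainTheorem7 (n : ℕ) :
    (∀ π : (∀ S : RackIsotropy.RackCat.{u}, (RackIsotropy.freeRack.{u} n ⟶ S) → (S ⟶ S)),
      RackIsotropy.IsIsotropy π ↔
        ∃! p : ℤ × RackIsotropy.ReducedWord n,
          ∀ (S : RackIsotropy.RackCat.{u}) (h : RackIsotropy.freeRack.{u} n ⟶ S) (r : S),
            π S h r =
              RackIsotropy.canonicalValue (fun i => h (RackIsotropy.FreeRack.gen i)) p.1 p.2.1 r) ∧
    (∀ h : RackIsotropy.freeRack.{u} n ⟶ RackIsotropy.freeRack.{u} n,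
      RackIsotropy.IsCategoricalInner h ↔
        ∃ p : ℤ × RackIsotropy.ReducedWord n, ∀ s : RackIsotropy.FreeRack.{u} n,
          h s = RackIsotropy.canonicalValue RackIsotropy.FreeRack.gen p.1 p.2.1 s) ∧
    (2 ≤ n → ∀ h : RackIsotropy.freeRack.{u} n ⟶ RackIsotropy.freeRack.{u} n,
      RackIsotropy.IsCategoricalInner h ↔
        ∃! p : ℤ × RackIsotropy.ReducedWord n, ∀ s : RackIsotropy.FreeRack.{u} n,
          h s = RackIsotropy.canonicalValue RackIsotropy.FreeRack.gen p.1 p.2.1 s) ∧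
    (∀ h : RackIsotropy.freeRack.{u} n ≅ RackIsotropy.freeRack.{u} n,
      RackIsotropy.IsCategoricalInner h.hom ↔
        RackIsotropy.IsAlgebraicInner (fun s : RackIsotropy.FreeRack.{u} n => h.hom s)) := by
  exact ⟨RackIsotropy.isIsotropy_iff_existsUnique, RackIsotropy.isCategoricalInner_iff_exists,
    fun hn => RackIsotropy.isCategoricalInner_iff_existsUnique hn,
    fun h => RackIsotropy.isCategoricalInner_iff_isAlgebraicInner h.hom⟩
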